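/- **Theorem (Test for Ideal Membership).** Let $R$ be a regular local ring of characteristic $p>0$, let $J=(g_1,\dots,g_t)$ be an ideal of $R$, and let $g\in R$. For $e\ge 0$ let $J^{[p^e]}:=(g_1^{p^e},\dots,g_t^{p^e})$ denote the Frobenius power of $J$. Then $g\in J$ if and only if there exists $c\in R\setminus\{0\}$ such that $c\cdot g^{p^e}\in J^{[p^e]}$ for all integers $e\ge 0$. -/

import Mathlib

/-- The Frobenius power `J^{[q]} = (g₁ ^ q, …, g_t ^ q)`, for `q = p ^ e`, of the ideal
`J = (g₁, …, g_t)`, written in terms of the given generators. -/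
def frobeniusPower {R : Type*} [CommRing R] {t : ℕ} (gens : Fin t → R) (q : ℕ) : Ideal R :=
  Ideal.span (Set.range fun i => gens i ^ q)

/-- In characteristic `p` the Frobenius power is the extension of `J` along the `e`-th iterate of
the Frobenius endomorphism; hence it depends only on `J` and not on the chosen generators. -/
theorem frobeniusPower_eq_map {R : Type*} [CommRing R] (p : ℕ) [Fact p.Prime] [CharP R p]
    {t : ℕ} (gens : Fin t → R) (e : ℕ) :
    frobeniusPower gens (p ^ e) =
      (Ideal.span (Set.range gens)).map (iterateFrobenius R p e) := by
  rw [frobeniusPower, Ideal.map_span, ← Set.range_comp]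
  rfl

/-! For `g ∈ J` take `c = 1`. Conversely, suppose `g ∉ J`. By Krull's intersection theorem `g ∉ I =
J + 𝔪^n` for some `n`, and some `y = j + r * g` with `j ∈ I` spans the socle direction: `y ∉ I`, `𝔪
y ⊆ I`. With `q = p ^ e`, additivity of Frobenius gives `c * y ^ q ∈ I^[q]`, so `c` lies in `I^[q] :
y ^ q = 𝔪^[q] ⊆ 𝔪^q` for every `e`, whence `c = 0`.

The colon formula (`iterateFrobenius_colon_eq`) is proved by counting lengths rather than by
flatness of Frobenius. Passing to Frobenius powers multiplies colength by at most `ℓ(R/𝔪^[q]) =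
q^d`, one socle step at a time (`length_quotient_map_add_le`). For powers of a regular sequence
generating `𝔪` the factor is exactly `q^d`, so no step can lose length. -/

/-! ### Colengths of powers of a regular sequence. -/

section RegularSequencePowers

open RingTheory.Sequence Pointwise Function

universe u v

variable {R : Type u} [CommRing R] {M M₂ M₃ : Type v}
  [AddCommGroup M] [Module R M] [AddCommGroup M₂] [Module R M₂] [AddCommGroup M₃] [Module R M₃]

theorem QuotSMulTop.map_injective_of_exact {r : R} {f : M →ₗ[R] M₂} {g : M₂ →ₗ[R] M₃}
    (hf : Injective f) (hfg : Exact f g) (h : IsSMulRegular M₃ r) :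
    Injective (QuotSMulTop.map r f) := by
  have h₀ : Exact (0 : M →ₗ[R] M) f := by
    rwa [LinearMap.exact_zero_iff_injective]
  have h₁ := QuotSMulTop.map_first_exact_on_four_term_exact_of_isSMulRegular_last h₀ hfg h
  rwa [map_zero, LinearMap.exact_zero_iff_injective] at h₁

theorem length_quotient_ofList_smul_top_of_exact {rs : List R} {f : M →ₗ[R] M₂} {g : M₂ →ₗ[R] M₃}
    (hf : Injective f) (hfg : Exact f g) (hg : Surjective g) (h : IsWeaklyRegular M₃ rs) :
    Module.length R (M₂ ⧸ (Ideal.ofList rs • ⊤ : Submodule R M₂)) =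
      Module.length R (M ⧸ (Ideal.ofList rs • ⊤ : Submodule R M)) +
        Module.length R (M₃ ⧸ (Ideal.ofList rs • ⊤ : Submodule R M₃)) := by
  induction rs generalizing M M₂ M₃ with
  | nil =>
    have hbot (N : Type v) [AddCommGroup N] [Module R N] :
        Module.length R (N ⧸ (Ideal.ofList ([] : List R) • ⊤ : Submodule R N)) =
          Module.length R N :=
      (Submodule.quotEquivOfEqBot (Ideal.ofList ([] : List R) • ⊤ : Submodule R N)
        (by rw [Ideal.ofList_nil (R := R), Submodule.bot_smul])).length_eq
    rw [hbot, hbot, hbot]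
    exact Module.length_eq_add_of_exact f g hf hg hfg
  | cons r rs ih =>
    rw [isWeaklyRegular_cons_iff] at h
    rw [(Submodule.quotOfListConsSMulTopEquivQuotSMulTopInner M r rs).length_eq,
      (Submodule.quotOfListConsSMulTopEquivQuotSMulTopInner M₂ r rs).length_eq,
      (Submodule.quotOfListConsSMulTopEquivQuotSMulTopInner M₃ r rs).length_eq]
    exact ih (QuotSMulTop.map_injective_of_exact hf hfg h.1) (QuotSMulTop.map_exact r hfg hg)
      (QuotSMulTop.map_surjective r hg) h.2

theorem isWeaklyRegular_of_exact {rs : List R} {f : M →ₗ[R] M₂} {g : M₂ →ₗ[R] M₃}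
    (hf : Injective f) (hfg : Exact f g) (hg : Surjective g) (h : IsWeaklyRegular M rs)
    (h₃ : IsWeaklyRegular M₃ rs) : IsWeaklyRegular M₂ rs := by
  induction rs generalizing M M₂ M₃ with
  | nil => simp
  | cons r rs ih =>
    rw [isWeaklyRegular_cons_iff] at h h₃ ⊢
    exact ⟨isSMulRegular_of_range_eq_ker hf hfg.linearMap_ker_eq.symm h.1 h₃.1,
      ih (QuotSMulTop.map_injective_of_exact hf hfg h₃.1) (QuotSMulTop.map_exact r hfg hg)
        (QuotSMulTop.map_surjective r hg) h.2 h₃.2⟩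

/-- `f` is multiplication by `x`, injective by regularity; `g` is the projection. -/
theorem exists_exact_quotSMulTop_pow_succ {x : R} (hx : IsSMulRegular M x) (a : ℕ) :
    ∃ (f : QuotSMulTop (x ^ a) M →ₗ[R] QuotSMulTop (x ^ (a + 1)) M)
      (g : QuotSMulTop (x ^ (a + 1)) M →ₗ[R] QuotSMulTop x M),
      Injective f ∧ Exact f g ∧ Surjective g := by
  refine ⟨Submodule.mapQ _ _ (LinearMap.lsmul R M x) ?_, Submodule.mapQ _ _ LinearMap.id ?_,
    ?_, ?_, ?_⟩
  · rintro _ ⟨m, -, rfl⟩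
    exact ⟨m, trivial, by simp [pow_succ', mul_smul, smul_comm x]⟩
  · rintro _ ⟨m, -, rfl⟩
    exact ⟨x ^ a • m, trivial, by simp [pow_succ', mul_smul, smul_comm x]⟩
  · rw [injective_iff_map_eq_zero]
    intro m hm
    obtain ⟨m, rfl⟩ := Submodule.mkQ_surjective _ m
    simp only [Submodule.mkQ_apply, Submodule.mapQ_apply, Submodule.Quotient.mk_eq_zero] at hm ⊢
    obtain ⟨n, -, hn⟩ := hm
    exact ⟨n, trivial, hx (by simpa [pow_succ', mul_smul] using hn)⟩
  · intro m
    obtain ⟨m, rfl⟩ := Submodule.mkQ_surjective _ m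
    simp only [Submodule.mkQ_apply, Submodule.mapQ_apply, Submodule.Quotient.mk_eq_zero]
    constructor
    · rintro ⟨n, -, hn⟩
      exact ⟨Submodule.Quotient.mk n, congrArg Submodule.Quotient.mk hn⟩
    · rintro ⟨n, hn⟩
      obtain ⟨n, rfl⟩ := Submodule.mkQ_surjective _ n
      simp only [Submodule.mkQ_apply, Submodule.mapQ_apply] at hn
      obtain ⟨k, -, hk⟩ := (Submodule.Quotient.eq _).1 hn
      refine ⟨n - x ^ a • k, trivial, ?_⟩
      simp only [DistribSMul.toLinearMap_apply, LinearMap.lsmul_apply, LinearMap.id_apply] at hk ⊢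
      rw [smul_sub, smul_smul, ← pow_succ', hk, sub_sub_cancel]
  · intro m
    obtain ⟨m, rfl⟩ := Submodule.mkQ_surjective _ m
    exact ⟨Submodule.Quotient.mk m, rfl⟩

theorem RingTheory.Sequence.IsWeaklyRegular.quotSMulTop_pow {x : R} {rs : List R}
    (h : IsWeaklyRegular M (x :: rs)) (a : ℕ) :
    IsWeaklyRegular (QuotSMulTop (x ^ a) M) rs ∧
    Module.length R (QuotSMulTop (x ^ a) M ⧸
      (Ideal.ofList rs • ⊤ : Submodule R (QuotSMulTop (x ^ a) M))) =
    a * Module.length R (QuotSMulTop x M ⧸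
      (Ideal.ofList rs • ⊤ : Submodule R (QuotSMulTop x M))) := by
  rw [isWeaklyRegular_cons_iff] at h
  induction a with
  | zero =>
    have : Subsingleton (QuotSMulTop (x ^ 0) M) := by
      rw [Submodule.Quotient.subsingleton_iff, pow_zero, one_smul]
    refine ⟨?_, ?_⟩
    · rw [isWeaklyRegular_iff]
      intro i hi
      exact injective_of_subsingleton _
    · simp
  | succ a ih =>
    obtain ⟨f, g, hf, hfg, hg⟩ := exists_exact_quotSMulTop_pow_succ h.1 a
    refine ⟨isWeaklyRegular_of_exact hf hfg hg ih.1 h.2, ?_⟩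
    rw [length_quotient_ofList_smul_top_of_exact hf hfg hg h.2, ih.2]
    push_cast
    ring

/-- The head is raised to its power first: the tail stays weakly regular on the new quotient, so no
permutation of the sequence is needed. -/
theorem RingTheory.Sequence.IsWeaklyRegular.length_quotient_pow {rs : List R}
    (h : IsWeaklyRegular M rs) (a : ℕ) :
    Module.length R (M ⧸ (Ideal.ofList (rs.map (· ^ a)) • ⊤ : Submodule R M)) =
      (a : ℕ∞) ^ rs.length * Module.length R (M ⧸ (Ideal.ofList rs • ⊤ : Submodule R M)) := by
  induction rs generalizing M with
  | nil => rw [List.map_nil, List.length_nil, pow_zero, one_mul]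
  | cons x rs ih =>
    rw [List.map_cons,
      (Submodule.quotOfListConsSMulTopEquivQuotSMulTopInner M (x ^ a) _).length_eq,
      (Submodule.quotOfListConsSMulTopEquivQuotSMulTopInner M x rs).length_eq,
      ih (h.quotSMulTop_pow a).1, (h.quotSMulTop_pow a).2, List.length_cons]
    ring

theorem RingTheory.Sequence.IsWeaklyRegular.length_quotient_ofList_pow {rs : List R}
    (h : IsWeaklyRegular R rs) (a : ℕ) :
    Module.length R (R ⧸ Ideal.ofList (rs.map (· ^ a))) =
      (a : ℕ∞) ^ rs.length * Module.length R (R ⧸ Ideal.ofList rs) := by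
  have := h.length_quotient_pow a
  rwa [smul_eq_mul, smul_eq_mul, Ideal.mul_top, Ideal.mul_top] at this

end RegularSequencePowers

/-! ### Regular local rings: domain property and regular generators of `𝔪`. -/

section RegularLocalRing

open IsLocalRing Pointwise

theorem exists_mem_maximalIdeal_notMem_sq_notMem_minimalPrimes {R : Type*} [CommRing R]
    [IsLocalRing R] [IsNoetherianRing R] (h : maximalIdeal R ∉ minimalPrimes R) :
    ∃ x ∈ maximalIdeal R, x ∉ maximalIdeal R ^ 2 ∧ ∀ P ∈ minimalPrimes R, x ∉ P := by
  have hfin := minimalPrimes.finite_of_isNoetherianRing R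
  classical
  by_contra! H
  have hsub : (maximalIdeal R : Set R) ⊆
      ⋃ I ∈ ((insert (maximalIdeal R ^ 2) hfin.toFinset : Finset (Ideal R)) : Set (Ideal R)),
        (I : Set R) := by
    intro x hx
    by_cases hx2 : x ∈ maximalIdeal R ^ 2
    · exact Set.mem_biUnion (by simp) hx2
    · obtain ⟨P, hP, hxP⟩ := H x hx hx2
      exact Set.mem_biUnion (by simp [hP]) hxP
  -- Prime avoidance tolerates two non-prime ideals; `𝔪^2` fills both slots.
  obtain ⟨I, hI, hle⟩ := (Ideal.subset_union_prime (f := id) (maximalIdeal R ^ 2)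
    (maximalIdeal R ^ 2) (fun I hI hne _ ↦ by
      simp only [Finset.mem_insert, Set.Finite.mem_toFinset] at hI
      exact (hI.resolve_left hne).1.1)).1 hsub
  simp only [Finset.mem_insert, Set.Finite.mem_toFinset] at hI
  rcases hI with rfl | hI
  · have hbot : maximalIdeal R = ⊥ := by
      refine Submodule.eq_bot_of_le_smul_of_le_jacobson_bot (maximalIdeal R) _
        (IsNoetherian.noetherian _) ?_ (maximalIdeal_le_jacobson _)
      rwa [smul_eq_mul, ← pow_two]
    apply h
    rw [hbot]
    exact ⟨⟨hbot ▸ inferInstance, bot_le⟩, fun _ _ _ ↦ bot_le⟩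
  · have : I = maximalIdeal R :=
      le_antisymm (le_maximalIdeal hI.1.1.ne_top) hle
    exact h (this ▸ hI)

/-- The class of `x` in the cotangent space is nonzero, hence extends to a basis; by Nakayama, lifts
of a basis generate `𝔪`. -/
theorem exists_generators_maximalIdeal_insert {R : Type*} [CommRing R]
    [IsLocalRing R] [IsNoetherianRing R] {x : R} (hx : x ∈ maximalIdeal R)
    (hx2 : x ∉ maximalIdeal R ^ 2) :
    ∃ s : Set R, s.Finite ∧ s.ncard + 1 ≤ (maximalIdeal R).spanFinrank ∧
      Ideal.span (insert x s) = maximalIdeal R := by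
  set v := (maximalIdeal R).toCotangent ⟨x, hx⟩ with hv
  have hv0 : v ≠ 0 := by rwa [Ne, Ideal.toCotangent_eq_zero]
  have hli : LinearIndepOn (ResidueField R) id ({v} : Set (CotangentSpace R)) :=
    LinearIndepOn.singleton hv0
  set B := hli.extend (Set.subset_univ _)
  let b := Module.Basis.extend hli
  have hvB : v ∈ B := hli.subset_extend _ rfl
  have hfin : B.Finite := Module.Finite.finite_basis b
  have hcard : B.ncard = (maximalIdeal R).spanFinrank := by
    rw [spanFinrank_maximalIdeal_eq_finrank_cotangentSpace, Module.finrank_eq_nat_card_basis b]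
    rfl
  have hspanB : Submodule.span (ResidueField R) B = ⊤ := by
    have := b.span_eq
    rwa [Module.Basis.range_extend] at this
  obtain ⟨l, hl⟩ := (maximalIdeal R).toCotangent_surjective.hasRightInverse
  let T : Set (maximalIdeal R) := insert ⟨x, hx⟩ (l '' (B \ {v}))
  have hT : (maximalIdeal R).toCotangent '' T = B := by
    rw [Set.image_insert_eq, Set.image_image]
    simp only [hl _, Set.image_id', ← hv, Set.insert_sdiff_singleton, Set.insert_eq_of_mem hvB]
  have hTspan := CotangentSpace.span_image_eq_top_iff.1 (hT ▸ hspanB)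
  refine ⟨(↑) '' (l '' (B \ {v})), (hfin.sdiff.image _).image _, ?_, ?_⟩
  · rw [← hcard, ← Set.ncard_sdiff_singleton_add_one hvB hfin]
    exact Nat.add_le_add_right
      ((Set.ncard_image_le (hfin.sdiff.image _)).trans (Set.ncard_image_le hfin.sdiff)) 1
  · have := congrArg (Submodule.map (maximalIdeal R).subtype) hTspan
    rw [Submodule.map_span, Submodule.map_top, Submodule.range_subtype, Set.image_insert_eq] at this
    exact this

theorem spanFinrank_maximalIdeal_quotient_span_singleton_add_one_le {R : Type*} [CommRing R]
    [IsLocalRing R] [IsNoetherianRing R] {x : R} (hx : x ∈ maximalIdeal R)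
    (hx2 : x ∉ maximalIdeal R ^ 2) [IsLocalRing (R ⧸ Ideal.span {x})] :
    (maximalIdeal (R ⧸ Ideal.span {x})).spanFinrank + 1 ≤ (maximalIdeal R).spanFinrank := by
  obtain ⟨s, hs, hcard, hspan⟩ := exists_generators_maximalIdeal_insert hx hx2
  refine le_trans (Nat.add_le_add_right ?_ 1) hcard
  have hm : maximalIdeal (R ⧸ Ideal.span {x}) = Ideal.span (Ideal.Quotient.mk _ '' s) := by
    have hx0 : Ideal.Quotient.mk (Ideal.span {x}) x = 0 :=
      Ideal.Quotient.eq_zero_iff_mem.2 (Ideal.mem_span_singleton_self x)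
    rw [← map_maximalIdeal_of_surjective _ Ideal.Quotient.mk_surjective, ← hspan, Ideal.map_span,
      Set.image_insert_eq, hx0, Ideal.span_insert_zero]
  rw [hm]
  exact (Submodule.spanFinrank_span_le_ncard_of_finite (hs.image _)).trans (Set.ncard_image_le hs)

/-- A regular local ring is a domain, and its maximal ideal is generated by a regular sequence. -/
theorem IsRegularLocalRing.isDomain_and_exists_isWeaklyRegular (n : ℕ) {R : Type*} [CommRing R]
    [IsRegularLocalRing R] (hn : (maximalIdeal R).spanFinrank = n) :
    IsDomain R ∧ ∃ rs : List R, Ideal.ofList rs = maximalIdeal R ∧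
      RingTheory.Sequence.IsWeaklyRegular R rs := by
  induction n generalizing R with
  | zero =>
    have hbot : maximalIdeal R = ⊥ :=
      (Submodule.spanFinrank_eq_zero_iff_eq_bot (IsNoetherian.noetherian _)).1 hn
    refine ⟨((isField_iff_maximalIdeal_eq).2 hbot).isDomain, [], by simp [hbot], by simp⟩
  | succ n ih =>
    have hdim := IsRegularLocalRing.spanFinrank_maximalIdeal (R := R)
    have hmin : maximalIdeal R ∉ minimalPrimes R := by
      intro h
      have h0 := Ideal.height_eq_zero_iff.2 h
      rw [← maximalIdeal_height_eq_ringKrullDim, h0, hn] at hdim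
      norm_cast at hdim
    obtain ⟨x, hx, hx2, hxP⟩ := exists_mem_maximalIdeal_notMem_sq_notMem_minimalPrimes hmin
    have hne : Ideal.span {x} ≠ ⊤ := by
      rwa [Ne, Ideal.span_singleton_eq_top]
    have : Nontrivial (R ⧸ Ideal.span {x}) := Ideal.Quotient.nontrivial_iff.2 hne
    have : IsLocalRing (R ⧸ Ideal.span {x}) :=
      .of_surjective' _ Ideal.Quotient.mk_surjective
    have h1 := spanFinrank_maximalIdeal_quotient_span_singleton_add_one_le hx hx2
    -- Modulo `x` the dimension drops by at most one and the number of generators by at least one,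
    -- so the quotient is again regular.
    have h2 : ringKrullDim R ≤ ringKrullDim (R ⧸ Ideal.span {x}) + 1 := by
      rw [← Finset.coe_singleton]
      exact_mod_cast ringKrullDim_le_ringKrullDim_quotient_add_card {x}
        (by simpa [ringJacobson_eq_maximalIdeal] using hx)
    have h3 : (n : WithBot ℕ∞) ≤ ringKrullDim (R ⧸ Ideal.span {x}) := by
      rw [← hdim, hn, Nat.cast_succ] at h2
      exact ENat.WithBot.add_le_add_one_right_iff.1 h2
    have hreg : IsRegularLocalRing (R ⧸ Ideal.span {x}) :=
      .of_spanFinrank_maximalIdeal_le _ (le_trans (by exact_mod_cast (by omega)) h3)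
    have hn' : (maximalIdeal (R ⧸ Ideal.span {x})).spanFinrank = n := by
      rw [← hreg.spanFinrank_maximalIdeal] at h3
      have : n ≤ (maximalIdeal (R ⧸ Ideal.span {x})).spanFinrank := by exact_mod_cast h3
      omega
    obtain ⟨hdom, rs', hrs', hwr⟩ := ih hn'
    have hprime : (Ideal.span {x}).IsPrime := (Ideal.Quotient.isDomain_iff_prime _).1 hdom
    obtain ⟨P, hP, hPx⟩ := Ideal.exists_minimalPrimes_le (bot_le : ⊥ ≤ Ideal.span {x})
    have hPp : P.IsPrime := hP.1.1
    -- Since `P ⊆ (x)` is prime and `x ∉ P`, `P = xP`; Nakayama applies.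
    have hPbot : P = ⊥ := by
      refine Submodule.eq_bot_of_le_smul_of_le_jacobson_bot (maximalIdeal R) _
        (IsNoetherian.noetherian _) ?_ (maximalIdeal_le_jacobson _)
      intro y hy
      obtain ⟨a, rfl⟩ := Ideal.mem_span_singleton.1 (hPx hy)
      exact Submodule.smul_mem_smul hx ((hPp.mem_or_mem hy).resolve_left (hxP P hP))
    have hdomR : IsDomain R := by
      subst hPbot
      exact IsDomain.of_bot_isPrime R
    refine ⟨hdomR, ?_⟩
    obtain ⟨rs, rfl⟩ : ∃ rs : List R, rs.map (Ideal.Quotient.mk (Ideal.span {x})) = rs' :=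
      List.map_surjective_iff.2 Ideal.Quotient.mk_surjective rs'
    refine ⟨x :: rs, ?_, ?_⟩
    · rw [Ideal.ofList_cons]
      rw [← Ideal.map_ofList,
        ← map_maximalIdeal_of_surjective _ Ideal.Quotient.mk_surjective] at hrs'
      have := congrArg (Ideal.comap (Ideal.Quotient.mk (Ideal.span {x}))) hrs'
      rw [Ideal.comap_map_of_surjective' _ Ideal.Quotient.mk_surjective,
        Ideal.comap_map_of_surjective' _ Ideal.Quotient.mk_surjective, Ideal.mk_ker] at this
      rw [sup_comm, this, sup_eq_left, Ideal.span_singleton_le_iff_mem]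
      exact hx
    · have hx0 : x ≠ 0 := fun h ↦ hx2 (h ▸ zero_mem _)
      refine (RingTheory.Sequence.isWeaklyRegular_cons_iff R x rs).2
        ⟨fun a b hab ↦ mul_left_cancel₀ hx0 hab, ?_⟩
      have hwr' : RingTheory.Sequence.IsWeaklyRegular (R ⧸ Ideal.span {x}) rs :=
        (RingTheory.Sequence.isWeaklyRegular_map_algebraMap_iff (R := R) (S := R ⧸ Ideal.span {x})
          (R ⧸ Ideal.span {x}) rs).1 hwr
      have heq : Ideal.span {x} = x • (⊤ : Ideal R) := by
        rw [← Submodule.ideal_span_singleton_smul, smul_eq_mul, Ideal.mul_top]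
      exact (LinearEquiv.isWeaklyRegular_congr (Submodule.quotEquivOfEq _ _ heq) rs).1 hwr'

end RegularLocalRing

/-! ### Colength under extension along a ring endomorphism. -/

section FrobeniusLength

open IsLocalRing

universe u

variable {R : Type u} [CommRing R]

/-- Multiplication by `h` identifies `R/(I : h)` with the kernel of `R/I → R/(I + (h))`. -/
theorem length_quotient_eq_length_sup_span_singleton_add_length_colon (I : Ideal R) (h : R) :
    Module.length R (R ⧸ I) = Module.length R (R ⧸ (I ⊔ Ideal.span {h})) +
      Module.length R (R ⧸ I.colon {h}) := by
  have hle : I.colon {h} ≤ Submodule.comap (LinearMap.mulRight R h) I := by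
    intro a ha
    simpa using Submodule.mem_colon_singleton.1 ha
  rw [add_comm]
  refine Module.length_eq_add_of_exact (Submodule.mapQ _ _ (LinearMap.mulRight R h) hle)
    (Submodule.factor (le_sup_left : I ≤ I ⊔ Ideal.span {h})) ?_
    (Submodule.factor_surjective _) ?_
  · rw [injective_iff_map_eq_zero]
    intro a ha
    obtain ⟨a, rfl⟩ := Submodule.mkQ_surjective _ a
    simp only [Submodule.mkQ_apply, Submodule.mapQ_apply, Submodule.Quotient.mk_eq_zero] at ha ⊢
    exact Submodule.mem_colon_singleton.2 (by simpa using ha)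
  · intro a
    obtain ⟨a, rfl⟩ := Submodule.mkQ_surjective _ a
    change (Submodule.Quotient.mk a : R ⧸ (I ⊔ Ideal.span {h})) = 0 ↔ _
    rw [Submodule.Quotient.mk_eq_zero]
    constructor
    · intro ha
      obtain ⟨i, hi, y, hy, rfl⟩ := Submodule.mem_sup.1 ha
      obtain ⟨r, rfl⟩ := Ideal.mem_span_singleton'.1 hy
      refine ⟨Submodule.Quotient.mk r, (Submodule.Quotient.eq _).2 ?_⟩
      simpa using hi
    · rintro ⟨r, hr⟩
      obtain ⟨r, rfl⟩ := Submodule.mkQ_surjective _ r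
      have := (Submodule.Quotient.eq _).1 hr
      rw [LinearMap.mulRight_apply] at this
      have h2 := Submodule.sub_mem (I ⊔ Ideal.span {h})
        (Submodule.mem_sup_right (Ideal.mul_mem_left _ r (Ideal.mem_span_singleton_self h)))
        (Submodule.mem_sup_left this)
      simpa using h2

theorem length_quotient_anti {I I' : Ideal R} (h : I ≤ I') :
    Module.length R (R ⧸ I') ≤ Module.length R (R ⧸ I) :=
  Module.length_le_of_surjective (Submodule.factor h) (Submodule.factor_surjective h)

theorem eq_of_le_of_length_quotient_le {I I' : Ideal R} (h : I ≤ I')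
    (hfin : Module.length R (R ⧸ I) ≠ ⊤)
    (hl : Module.length R (R ⧸ I) ≤ Module.length R (R ⧸ I')) : I = I' := by
  refine le_antisymm h fun x hx ↦ ?_
  have h1 := length_quotient_eq_length_sup_span_singleton_add_length_colon I x
  have h2 := length_quotient_anti (sup_le h (by simpa [Ideal.span_le] using hx) :
    I ⊔ Ideal.span {x} ≤ I')
  have h3 : Module.length R (R ⧸ I.colon {x}) = 0 := by
    generalize Module.length R (R ⧸ I.colon {x}) = c at *
    generalize Module.length R (R ⧸ I) = a at *
    generalize Module.length R (R ⧸ (I ⊔ Ideal.span {x})) = b at *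
    lift a to ℕ using hfin
    have hb : b ≠ ⊤ := by rintro rfl; simp at h1
    have hc : c ≠ ⊤ := by rintro rfl; simp at h1
    lift b to ℕ using hb
    lift c to ℕ using hc
    have h4 := hl.trans h2
    norm_cast at *
    omega
  rw [Module.length_eq_zero_iff, Submodule.Quotient.subsingleton_iff] at h3
  have h4 : (1 : R) ∈ I.colon {x} := h3 ▸ Submodule.mem_top
  simpa using Submodule.mem_colon_singleton.1 h4

/-- Take `y` in the last product `𝔪^k I'` not contained in `I`. -/
theorem exists_mul_mem_of_lt_of_pow_le {I I' 𝔪 : Ideal R} (h : I < I') {n : ℕ} (hn : 𝔪 ^ n ≤ I) :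
    ∃ y ∈ I', y ∉ I ∧ ∀ r ∈ 𝔪, r * y ∈ I := by
  classical
  have hex : ∃ k, 𝔪 ^ k * I' ≤ I := ⟨n, Ideal.mul_le_left.trans hn⟩
  obtain ⟨k, hk⟩ : ∃ k, Nat.find hex = k + 1 := by
    refine Nat.exists_eq_succ_of_ne_zero fun h0 ↦ ?_
    have := Nat.find_spec hex
    rw [h0, pow_zero, Ideal.one_eq_top, Ideal.top_mul] at this
    exact h.not_ge this
  obtain ⟨y, hy, hyI⟩ := SetLike.not_le_iff_exists.1 (Nat.find_min hex (by omega : k < _))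
  refine ⟨y, Ideal.mul_le_right hy, hyI, fun r hr ↦ ?_⟩
  apply Nat.find_spec hex
  rw [hk, pow_succ', mul_assoc]
  exact Ideal.mul_mem_mul hr hy

variable [IsLocalRing R]

theorem colon_singleton_eq_maximalIdeal {I : Ideal R} {y : R} (hy : y ∉ I)
    (h : ∀ r ∈ maximalIdeal R, r * y ∈ I) : I.colon {y} = maximalIdeal R := by
  refine le_antisymm (le_maximalIdeal fun h1 ↦ hy ?_)
    fun r hr ↦ Submodule.mem_colon_singleton.2 (h r hr)
  have h4 : (1 : R) ∈ I.colon {y} := h1 ▸ Submodule.mem_top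
  simpa using Submodule.mem_colon_singleton.1 h4

theorem length_quotient_maximalIdeal : Module.length R (R ⧸ maximalIdeal R) = 1 := by
  have := isSimpleModule_iff_isCoatom.2 (maximalIdeal.isMaximal R).out
  exact Module.length_eq_one R _

theorem length_quotient_eq_length_sup_span_singleton_add_one {I : Ideal R} {y : R} (hy : y ∉ I)
    (h : ∀ r ∈ maximalIdeal R, r * y ∈ I) :
    Module.length R (R ⧸ I) = Module.length R (R ⧸ (I ⊔ Ideal.span {y})) + 1 := by
  rw [length_quotient_eq_length_sup_span_singleton_add_length_colon I y,
    colon_singleton_eq_maximalIdeal hy h, length_quotient_maximalIdeal]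

theorem map_maximalIdeal_le_colon {I : Ideal R} {y : R} (f : R →+* R)
    (h : ∀ r ∈ maximalIdeal R, r * y ∈ I) :
    (maximalIdeal R).map f ≤ (I.map f).colon {f y} := by
  rw [Ideal.map_le_iff_le_comap]
  intro r hr
  rw [Ideal.mem_comap, Submodule.mem_colon_singleton, smul_eq_mul, ← map_mul]
  exact Ideal.mem_map_of_mem f (h r hr)

/-- The defect `ℓ(R/f(I)R) - ℓ(R/f(𝔪)R) * ℓ(R/I)` grows with `I`, stated without subtraction.
Adjoining a socle element lowers `ℓ(R/I)` by one and `ℓ(R/f(I)R)` by at most `ℓ(R/f(𝔪)R)`. -/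
theorem length_quotient_map_add_le [IsNoetherianRing R] (f : R →+* R) {n : ℕ} {I I' : Ideal R}
    (hn : maximalIdeal R ^ n ≤ I) (h : I ≤ I') :
    Module.length R (R ⧸ I.map f) +
        Module.length R (R ⧸ (maximalIdeal R).map f) * Module.length R (R ⧸ I') ≤
      Module.length R (R ⧸ I'.map f) +
        Module.length R (R ⧸ (maximalIdeal R).map f) * Module.length R (R ⧸ I) := by
  induction I using WellFoundedGT.induction with
  | ind I ih =>
    rcases h.eq_or_lt with rfl | hlt
    · exact le_rfl
    obtain ⟨y, hy, hyI, hym⟩ := exists_mul_mem_of_lt_of_pow_le hlt hn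
    have hI₁ : I < I ⊔ Ideal.span {y} := by simpa [Ideal.span_le, sup_eq_left] using hyI
    have := ih _ hI₁ (hn.trans hI₁.le) (sup_le h (by simpa [Ideal.span_le] using hy))
    rw [length_quotient_eq_length_sup_span_singleton_add_one hyI hym,
      length_quotient_eq_length_sup_span_singleton_add_length_colon (I.map f) (f y), mul_add,
      mul_one, ← add_assoc]
    rw [Ideal.map_sup, Ideal.map_span, Set.image_singleton] at this
    refine le_trans ?_ (add_le_add this (length_quotient_anti (map_maximalIdeal_le_colon f hym)))
    rw [add_right_comm]

end FrobeniusLength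

/-! ### The colon formula and the membership test. -/

section FrobeniusColon

open IsLocalRing RingTheory.Sequence

variable {R : Type*} [CommRing R] [IsLocalRing R]

theorem length_quotient_ofList_pow_eq {rs : List R} (hwr : IsWeaklyRegular R rs)
    (hrs : Ideal.ofList rs = maximalIdeal R) (a : ℕ) :
    Module.length R (R ⧸ Ideal.ofList (rs.map (· ^ a))) = (a : ℕ∞) ^ rs.length := by
  rw [hwr.length_quotient_ofList_pow, hrs, length_quotient_maximalIdeal, mul_one]

theorem iterateFrobenius_colon_eq [IsNoetherianRing R] (p : ℕ) [Fact p.Prime] [CharP R p]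
    {rs : List R} (hwr : IsWeaklyRegular R rs) (hrs : Ideal.ofList rs = maximalIdeal R)
    {J : Ideal R} {n : ℕ} (hn : maximalIdeal R ^ n ≤ J) {y : R} (hy : y ∉ J)
    (hym : ∀ r ∈ maximalIdeal R, r * y ∈ J) (e : ℕ) :
    (J.map (iterateFrobenius R p e)).colon {y ^ p ^ e} =
      (maximalIdeal R).map (iterateFrobenius R p e) := by
  set f := iterateFrobenius R p e with hf
  have hfy : f y = y ^ p ^ e := rfl
  rw [← hfy]
  symm
  -- A subideal of `J` whose defect vanishes: its colength is `n^d`, and that of `P^[q]` is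
  -- `(nq)^d`.
  set P := Ideal.ofList (rs.map (· ^ n)) with hP
  have hPJ : P ≤ J := by
    refine le_trans (Ideal.span_le.2 ?_) hn
    intro x hx
    obtain ⟨r, hr, rfl⟩ := List.mem_map.1 hx
    exact Ideal.pow_mem_pow (hrs ▸ Ideal.subset_span hr) n
  have hmap (a : ℕ) : (Ideal.ofList (rs.map (· ^ a))).map f =
      Ideal.ofList (rs.map (· ^ (a * p ^ e))) := by
    rw [Ideal.map_ofList, List.map_map]
    congr 2
    ext x
    simp [hf, iterateFrobenius_def, pow_mul]
  have hmm : (maximalIdeal R).map f = Ideal.ofList (rs.map (· ^ (p ^ e))) := by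
    have := hmap 1
    simpa [hrs] using this
  have hlm : Module.length R (R ⧸ (maximalIdeal R).map f) = ((p ^ e : ℕ) : ℕ∞) ^ rs.length := by
    rw [hmm, length_quotient_ofList_pow_eq hwr hrs]
  have hlP := length_quotient_ofList_pow_eq hwr hrs n
  have hlPq : Module.length R (R ⧸ P.map f) = ((n * p ^ e : ℕ) : ℕ∞) ^ rs.length := by
    rw [hmap, length_quotient_ofList_pow_eq hwr hrs]
  have hPm : ∃ k, maximalIdeal R ^ k ≤ P := by
    refine Ideal.exists_pow_le_of_le_radical_of_fg ?_ (IsNoetherian.noetherian _)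
    rw [← hrs]
    exact Ideal.span_le.2 fun x hx ↦ ⟨n, Ideal.subset_span (List.mem_map_of_mem hx)⟩
  obtain ⟨k, hk⟩ := hPm
  -- In `P ⊆ J ⊂ J + (y) ⊆ R` the defects of `P` and `R` are zero, so that of `J` is at least that
  -- of `J + (y)`; hence the colon has colength at least `q^d`.
  have h1 := length_quotient_map_add_le f hk hPJ
  have h2 := length_quotient_map_add_le f (hn.trans le_sup_left)
    (le_top : J ⊔ Ideal.span {y} ≤ ⊤)
  have h3 := length_quotient_eq_length_sup_span_singleton_add_one hy hym
  have h4 := length_quotient_eq_length_sup_span_singleton_add_length_colon (J.map f) (f y)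
  have h5 := length_quotient_anti hPJ
  have h6 := length_quotient_anti (Ideal.map_mono hPJ : P.map f ≤ J.map f)
  rw [← Set.image_singleton, ← Ideal.map_span, ← Ideal.map_sup, Set.image_singleton] at h4
  rw [← hP] at hlP
  refine eq_of_le_of_length_quotient_le (map_maximalIdeal_le_colon f hym)
    (by rw [hlm]; exact_mod_cast ENat.natCast_ne_top _) ?_
  have h7 : Module.length R (R ⧸ (⊤ : Ideal R)) = 0 := Module.length_eq_zero
  have h8 : Module.length R (R ⧸ (⊤ : Ideal R).map f) = 0 := by
    rw [Ideal.map_top, h7]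
  rw [h7, h8] at h2
  rw [hlm] at h1 h2 ⊢
  rw [hlP] at h1 h5
  rw [hlPq] at h1 h6
  generalize Module.length R (R ⧸ (J.map f).colon {f y}) = c at *
  generalize Module.length R (R ⧸ J.map f) = a at *
  generalize Module.length R (R ⧸ J) = b at *
  generalize Module.length R (R ⧸ (J ⊔ Ideal.span {y}).map f) = a' at *
  generalize Module.length R (R ⧸ (J ⊔ Ideal.span {y})) = b' at *
  norm_cast at h1 h2 h5 h6 ⊢
  lift b to ℕ using ne_top_of_le_ne_top (ENat.natCast_ne_top _) h5
  lift a to ℕ using ne_top_of_le_ne_top (ENat.natCast_ne_top _) h6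
  have hb : b' ≠ ⊤ := by rintro rfl; simp at h3
  have ha : a' ≠ ⊤ := by rintro rfl; simp at h4
  have hc : c ≠ ⊤ := by rintro rfl; simp at h4
  lift b' to ℕ using hb
  lift a' to ℕ using ha
  lift c to ℕ using hc
  norm_cast at *
  rw [mul_pow, mul_comm (n ^ _)] at h1
  subst h3
  rw [mul_add] at h1
  simp only [Nat.mul_zero, add_zero, zero_add] at h2
  omega

theorem mem_of_forall_mul_pow_mem [IsNoetherianRing R] (p : ℕ) [Fact p.Prime] [CharP R p]
    {rs : List R} (hwr : IsWeaklyRegular R rs) (hrs : Ideal.ofList rs = maximalIdeal R)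
    {J : Ideal R} {c g : R} (hc : c ≠ 0)
    (h : ∀ e, c * g ^ p ^ e ∈ J.map (iterateFrobenius R p e)) : g ∈ J := by
  by_contra hg
  obtain ⟨n, hn⟩ : ∃ n, g ∉ J ⊔ maximalIdeal R ^ n := by
    by_contra! H
    -- Krull's intersection theorem, applied to the module `R/J`.
    have h0 : (Submodule.Quotient.mk g : R ⧸ J) ∈
        (⨅ i : ℕ, maximalIdeal R ^ i • ⊤ : Submodule R (R ⧸ J)) := by
      rw [Submodule.mem_iInf]
      intro i
      obtain ⟨a, ha, b, hb, hab⟩ := Submodule.mem_sup.1 (H i)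
      have : (Submodule.Quotient.mk g : R ⧸ J) = b • Submodule.Quotient.mk 1 := by
        rw [← Submodule.Quotient.mk_smul, Submodule.Quotient.eq, ← hab]
        simpa using ha
      rw [this]
      exact Submodule.smul_mem_smul hb trivial
    rw [Ideal.iInf_pow_smul_eq_bot_of_isLocalRing _ (maximalIdeal.isMaximal R).ne_top,
      Submodule.mem_bot, Submodule.Quotient.mk_eq_zero] at h0
    exact hg h0
  have hlt : J ⊔ maximalIdeal R ^ n < (J ⊔ maximalIdeal R ^ n) ⊔ Ideal.span {g} := by
    simpa [Ideal.span_le] using hn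
  obtain ⟨y, hy, hyJ, hym⟩ := exists_mul_mem_of_lt_of_pow_le hlt
    (le_sup_right : maximalIdeal R ^ n ≤ _)
  obtain ⟨j, hj, z, hz, rfl⟩ := Submodule.mem_sup.1 hy
  obtain ⟨r, rfl⟩ := Ideal.mem_span_singleton'.1 hz
  have key (e : ℕ) : c ∈ maximalIdeal R ^ e := by
    have h1 : c ∈ (maximalIdeal R).map (iterateFrobenius R p e) := by
      rw [← iterateFrobenius_colon_eq p hwr hrs le_sup_right hyJ hym e,
        Submodule.mem_colon_singleton, smul_eq_mul, add_pow_char_pow, mul_add, mul_pow,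
        mul_left_comm]
      exact add_mem (Ideal.mul_mem_left _ _ (Ideal.mem_map_of_mem (iterateFrobenius R p e) hj))
        (Ideal.mul_mem_left _ _ (Ideal.map_mono le_sup_left (h e)))
    have h2 : (maximalIdeal R).map (iterateFrobenius R p e) ≤ maximalIdeal R ^ p ^ e := by
      rw [Ideal.map_le_iff_le_comap]
      exact fun x hx ↦ Ideal.pow_mem_pow hx _
    exact Ideal.pow_le_pow_right (Nat.lt_pow_self (Fact.out : p.Prime).one_lt).le (h2 h1)
  apply hc
  rw [← Ideal.mem_bot, ← Ideal.iInf_pow_eq_bot_of_isLocalRing (maximalIdeal R)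
    (maximalIdeal.isMaximal R).ne_top, Submodule.mem_iInf]
  exact key

end FrobeniusColon

theorem mainTheorem3 {R : Type*} [CommRing R] [IsRegularLocalRing R]
    (p : ℕ) (hp : 0 < p) [CharP R p]
    {t : ℕ} (gens : Fin t → R) (J : Ideal R) (hJ : J = Ideal.span (Set.range gens)) (g : R) :
    g ∈ J ↔ ∃ c : R, c ≠ 0 ∧ ∀ e : ℕ, c * g ^ (p ^ e) ∈ frobeniusPower gens (p ^ e) := by
  obtain ⟨hdom, rs, hrs, hwr⟩ :=
    IsRegularLocalRing.isDomain_and_exists_isWeaklyRegular _ (R := R) rfl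
  have : Fact p.Prime := ⟨CharP.char_prime_of_ne_zero R hp.ne'⟩
  simp only [frobeniusPower_eq_map, ← hJ]
  constructor
  · intro hg
    exact ⟨1, one_ne_zero, fun e ↦ by
      rw [one_mul]
      exact Ideal.mem_map_of_mem (iterateFrobenius R p e) hg⟩
  · rintro ⟨c, hc, h⟩
    exact mem_of_forall_mul_pow_mem p hwr hrs hc h
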